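/- Let $H$ be a separable complex Hilbert space and let $\Sigma$ be a nonnegative operator measure in $H$ on the bounded Borel subsets $\mathcal B_b(\mathbb R)$ of $\mathbb R$: each $\Sigma(\delta)$, $\delta\in\mathcal B_b(\mathbb R)$, is a nonnegative bounded operator in $H$, and $\Sigma\bigl(\bigcup_n\delta_n\bigr)f=\sum_n\Sigma(\delta_n)f$ for all $f\in H$ and all pairwise disjoint $\delta_1,\delta_2,\dots\in\mathcal B_b(\mathbb R)$ with bounded union. (Equivalently, $\Sigma$ is generated by a nondecreasing, strongly left continuous function $\Sigma(t)=\Sigma(t)^*$ with values in $B(H)$, $\Sigma([a,b))=\Sigma(b)-\Sigma(a)$.) Two measures are called equivalent, $\sim$, if they have the same null sets in $\mathcal B_b(\mathbb R)$. A vector $h\in H$ is of maximal type for $\Sigma$ if $\mu_h\sim\Sigma$, where $\mu_h(\delta)=(\Sigma(\delta)h,h)$. Let $\rho\sim\Sigma$ be a $\sigma$-finite Borel measure on $\mathbb R$ and let $(b_i)$ be an orthonormal basis of $H$. The multiplicity function of $\Sigma$ is $$N_\Sigma(t)=\sup_{n\ge1}\operatorname{rank}\left(\frac{d(\Sigma b_i,b_j)}{d\rho}(t)\right)_{i,j\le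 n}\in\{0,1,\dots,\infty\}$$ (if $\dim H<\infty$, only $n\le\dim H$ are taken). Put $\Gamma_i(\Sigma)=\{t\in\mathbb R: N_\Sigma(t)\ge i\}$ and let $m=m(\Sigma)\in\{0,1,\dots,\infty\}$ be the $\rho$-essential supremum of $N_\Sigma$. For a finite-dimensional subspace $L\subset H$ with orthogonal projection $P_L$, the compression $P_L\Sigma\lceil L$ is an operator measure in $L$; define $\Gamma_i(P_L\Sigma\lceil L)$ in the same way, with the same $\rho$ and an orthonormal basis of $L$. A subspace $L$ is a $k$-th Hellinger subspace for $\Sigma$ if $\dim L=k$ and $\Gamma_i(P_L\Sigma\lceil L)=\Gamma_i(\Sigma)$ modulo $\rho$-null sets for $1\le i\le k$. A Hellinger chain is a chain of subspaces $H_1\subset H_2\subset\dots\subset H_m$ (an infinite sequence $H_1\subset H_2\subset\dots$ if $m=\infty$, the empty chain if $m=0$) in which $H_k$ is a $k$-th Hellinger subspace for every finite $k$ with $1\le k\le m$. Then: 1. For every vector $h$ of maximal type for $\Sigma$ there is a Hellinger chain, in particular with $\dim H_k=k$, such that $H_1=\operatorname{span}\{h\}$ (if $m\ge1$). The chain does not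 depend on the choice of $\rho$ and of the orthonormal bases. 2. Let $(e_i)_{1\le i\le m}$ ($i$ finite) be linearly independent vectors in $H$, $H_k=\operatorname{span}\{e_1,\dots,e_k\}$, and $\Psi_k(t)=\left(\frac{d(\Sigma e_i,e_j)}{d\rho}(t)\right)_{i,j=1}^k$. Then $H_1\subset H_2\subset\dots\subset H_m$ is a Hellinger chain if and only if, for every finite $k$ with $1\le k\le m$, $$\Gamma_k(\Sigma)=\{t\in\mathbb R:\det\Psi_k(t)\ne0\}\quad\text{modulo }\rho\text{-null sets}.$$ -/

import Mathlib

open MeasureTheory Set Filter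

universe u v

/-- A (nonnegative) operator measure on the line: to every bounded Borel set it assigns a
nonnegative bounded operator in `H`, and it is strongly countably additive on bounded Borel sets.
The values on other sets are irrelevant. -/
structure OperatorMeasure (H : Type u) [NormedAddCommGroup H] [InnerProductSpace ℂ H] where
  /-- the operator attached to a set -/
  toFun : Set ℝ → (H →L[ℂ] H)
  isPositive' : ∀ δ : Set ℝ, MeasurableSet δ → Bornology.IsBounded δ → (toFun δ).IsPositive
  hasSum' : ∀ δ : ℕ → Set ℝ, (∀ n, MeasurableSet (δ n)) → Pairwise (Function.onFun Disjoint δ) →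
    Bornology.IsBounded (⋃ n, δ n) →
    ∀ f : H, HasSum (fun n => toFun (δ n) f) (toFun (⋃ n, δ n) f)

namespace OperatorMeasure

section

variable {H : Type u} [NormedAddCommGroup H] [InnerProductSpace ℂ H]

instance : CoeFun (OperatorMeasure H) (fun _ => Set ℝ → (H →L[ℂ] H)) := ⟨OperatorMeasure.toFun⟩

theorem apply_empty (S : OperatorMeasure H) (f : H) : S ∅ f = 0 := by
  have h := S.hasSum' (fun _ => ∅) (fun _ => MeasurableSet.empty)
    (fun _ _ _ => disjoint_bot_left) (by simp) f
  exact tendsto_nhds_unique tendsto_const_nhds h.summable.tendsto_atTop_zero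

/-- The compression `P_L S ↾ L` of an operator measure to a subspace `L`. -/
noncomputable def compress (S : OperatorMeasure H) (L : Submodule ℂ H)
    [L.HasOrthogonalProjection] : OperatorMeasure L where
  toFun δ := L.orthogonalProjectionOnto ∘L S δ ∘L L.subtypeL
  isPositive' δ hm hb := by
    refine ⟨?_, ?_⟩
    · intro x y
      have h := (S.isPositive' δ hm hb).isSymmetric (x : H) (y : H)
      change inner ℂ (L.orthogonalProjectionOnto (S.toFun δ x)) y =
        inner ℂ x (L.orthogonalProjectionOnto (S.toFun δ y))
      rw [Submodule.inner_orthogonalProjectionOnto_eq_of_mem_right,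
        Submodule.inner_orthogonalProjectionOnto_eq_of_mem_left]
      exact h
    · intro x
      have h := (S.isPositive' δ hm hb).re_inner_nonneg_left (x : H)
      change 0 ≤ RCLike.re (inner ℂ (L.orthogonalProjectionOnto (S.toFun δ x)) x)
      rw [Submodule.inner_orthogonalProjectionOnto_eq_of_mem_right]
      exact h
  hasSum' δ hm hd hb f :=
    (S.hasSum' δ hm hd hb (f : H)).mapL L.orthogonalProjectionOnto

/-- The scalar measure `ρ` is equivalent to the operator measure `S`: both have the same
bounded Borel null sets. -/
def IsEquivalent (S : OperatorMeasure H) (ρ : Measure ℝ) : Prop :=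
  ∀ δ : Set ℝ, MeasurableSet δ → Bornology.IsBounded δ → (S δ = 0 ↔ ρ δ = 0)

/-- The vectors of maximal type for `S`: those `f` for which the scalar measure
`μ_f(δ) = (S(δ) f, f)` is equivalent to `S`. -/
def maximalVectors (S : OperatorMeasure H) : Set H :=
  {f | ∀ δ : Set ℝ, MeasurableSet δ → Bornology.IsBounded δ → (S δ = 0 ↔ inner ℂ f (S δ f) = 0)}

open Classical in
/-- The complex measure `δ ↦ (S(δ ∩ [n, n + 1)) f, g)`, the restriction to `[n, n + 1)` of
`δ ↦ (S(δ) f, g)`. Here `(x, g)` is linear in `x`, so it is `inner ℂ g x`. -/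
noncomputable def matrixElement (S : OperatorMeasure H) (n : ℤ) (f g : H) : ComplexMeasure ℝ where
  measureOf' δ := if MeasurableSet δ then inner ℂ g (S (δ ∩ Ico (n : ℝ) (n + 1)) f) else 0
  empty' := by simp [apply_empty]
  not_measurable' δ hδ := by simp [hδ]
  m_iUnion' δ hm hd := by
    have hb : Bornology.IsBounded (⋃ i, δ i ∩ Ico (n : ℝ) (n + 1)) :=
      (Metric.isBounded_Ico (n : ℝ) (n + 1)).subset (iUnion_subset fun i => inter_subset_right)
    have h := S.hasSum' (fun i => δ i ∩ Ico (n : ℝ) (n + 1))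
      (fun i => (hm i).inter measurableSet_Ico)
      (fun i j hij => (hd hij).mono inter_subset_left inter_subset_left) hb f
    have h2 := h.mapL (innerSL ℂ g)
    simpa [hm, MeasurableSet.iUnion hm, iUnion_inter] using h2

/-- The density `d(S f, g)/dρ` of `δ ↦ (S(δ) f, g)` with respect to `ρ`, taken on each of the
intervals `[n, n + 1)` as the Radon-Nikodym derivative of a complex measure. -/
noncomputable def density (S : OperatorMeasure H) (ρ : Measure ℝ) (f g : H) (t : ℝ) : ℂ :=
  (S.matrixElement ⌊t⌋ f g).rnDeriv ρ t

/-- The matrix `(ψ_ij(t))` of the densities `ψ_ij = d(S e_i, e_j)/dρ`. -/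
noncomputable def densityMatrix (S : OperatorMeasure H) (ρ : Measure ℝ) {κ : Type*} (e : κ → H)
    (t : ℝ) : Matrix κ κ ℂ :=
  Matrix.of fun i j => S.density ρ (e i) (e j) t

/-- The multiplicity function of `S`, computed from the scalar measure `ρ` and the orthonormal
basis `e`: the supremum of the ranks of the finite principal submatrices of the matrix of
densities. For a basis `e_1, e_2, …` it is the supremum of the ranks of the leading ones. -/
noncomputable def multiplicity (S : OperatorMeasure H) (ρ : Measure ℝ) {ι : Type*} (e : ι → H)
    (t : ℝ) : ℕ∞ :=
  ⨆ s : Finset ι, ((S.densityMatrix ρ (fun i : s => e i) t).rank : ℕ∞)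

/-- The total multiplicity, the essential supremum of the multiplicity function. -/
noncomputable def totalMultiplicity (S : OperatorMeasure H) (ρ : Measure ℝ) {ι : Type*}
    (e : ι → H) : ℕ∞ :=
  essSup (S.multiplicity ρ e) ρ

/-- The support `Γ_i = {t | N(t) ≥ i}` of the `i`-th Hellinger type. -/
def hellingerSupport (S : OperatorMeasure H) (ρ : Measure ℝ) {ι : Type*} (e : ι → H) (i : ℕ) :
    Set ℝ :=
  {t | (i : ℕ∞) ≤ S.multiplicity ρ e t}

/-- `L` is a `k`-th Hellinger subspace for `S`: `dim L = k`, and `P_L S ↾ L` has the same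
Hellinger supports as `S` up to the `k`-th one, modulo null sets. -/
def IsHellingerSubspace (S : OperatorMeasure H) (ρ : Measure ℝ) {ι : Type*} (e : ι → H)
    (k : ℕ) (L : Submodule ℂ H) : Prop :=
  ∃ _ : FiniteDimensional ℂ L, Module.finrank ℂ L = k ∧
    ∀ c : OrthonormalBasis (Fin k) ℂ L, ∀ i : ℕ, 1 ≤ i → i ≤ k →
      (S.compress L).hellingerSupport ρ c i =ᵐ[ρ] S.hellingerSupport ρ e i

/-- `K 1 ⊂ K 2 ⊂ … ⊂ K m` is a Hellinger chain for `S`, where `m ≤ ∞` is the total multiplicity: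
the `K k` with `1 ≤ k ≤ m`, `k` finite, increase, and `K k` is a `k`-th Hellinger subspace.
The other members of the sequence are irrelevant. -/
def IsHellingerChain (S : OperatorMeasure H) (ρ : Measure ℝ) {ι : Type*} (e : ι → H)
    (K : ℕ → Submodule ℂ H) : Prop :=
  (∀ k : ℕ, 1 ≤ k → (k : ℕ∞) ≤ S.totalMultiplicity ρ e → S.IsHellingerSubspace ρ e k (K k)) ∧
  (∀ k : ℕ, 1 ≤ k → ((k + 1 : ℕ) : ℕ∞) ≤ S.totalMultiplicity ρ e → K k ≤ K (k + 1))

end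

end OperatorMeasure

open scoped Topology ENNReal NNReal ComplexConjugate ComplexOrder

/-! ### Densities with respect to the scalar measure: measurability, sesquilinearity, positivity -/

namespace OperatorMeasure

variable {H : Type u} [NormedAddCommGroup H] [InnerProductSpace ℂ H]

/-! For a.e. `t` the density matrix of finitely many vectors is positive semidefinite, hence a
transposed Gram matrix of vectors in a fibre at `t`, and these obey any prescribed countable set of
constant-coefficient relations among the original vectors (`ae_exists_gram`). Ranks and determinants
thus become dimensions and linear independence in the fibre.

The chain is spanned by a greedy sequence: given `e_0, …, e_{k-1}`, the next vector must make the
enlarged determinant nonzero at a.e. `t` where some vector could. Such a vector exists by Baire's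
theorem (`exists_snoc_det_ne_zero`): relative to one competitor `y`, the vectors failing on a set of
measure less than `c` form an open set, as densities converge a.e. along geometrically fast
sequences, and a dense one, as the failure sets of `x + s • y` for distinct `s` are disjoint up to
null sets. A vector of maximal type is an admissible start. By exchange in the fibre, `det Ψ_k ≠ 0`
a.e. where any finite family has rank at least `k`, so `Γ_k = {det Ψ_k ≠ 0}` modulo null sets.

This is the criterion of the second claim, which compares the rank of the density matrix on `H_k`
with that of `Ψ_k`. Changing `ρ` rescales densities by a positive factor and preserves everything.
-/

theorem ae_of_forall_Ico {ρ : Measure ℝ} {p : ℝ → Prop}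
    (h : ∀ n : ℤ, ∀ᵐ t ∂ρ.restrict (Ico (n : ℝ) (n + 1)), p t) : ∀ᵐ t ∂ρ, p t := by
  have h' : ∀ᵐ t ∂ρ, ∀ n : ℤ, t ∈ Ico (n : ℝ) (n + 1) → p t :=
    ae_all_iff.2 fun n => (ae_restrict_iff' measurableSet_Ico).1 (h n)
  filter_upwards [h'] with t ht
  exact ht ⌊t⌋ ⟨Int.floor_le t, Int.lt_floor_add_one t⟩

theorem _root_.MeasureTheory.ComplexMeasure.measurable_rnDeriv {α : Type*} [MeasurableSpace α]
    (c : ComplexMeasure α) (μ : Measure α) : Measurable (c.rnDeriv μ) :=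
  measurable_of_re_im (SignedMeasure.measurable_rnDeriv c.re μ)
    (SignedMeasure.measurable_rnDeriv c.im μ)

theorem measurable_density (S : OperatorMeasure H) (ρ : Measure ℝ) (f g : H) :
    Measurable (S.density ρ f g) := by
  -- The derivative used at `t` depends on `⌊t⌋`; joint measurability suffices because `ℤ` is
  -- countable.
  have h : Measurable fun p : ℤ × ℝ => (S.matrixElement p.1 f g).rnDeriv ρ p.2 :=
    measurable_from_prod_countable_right fun n => (S.matrixElement n f g).measurable_rnDeriv ρ
  have h' : Measurable fun t : ℝ => ((⌊t⌋, t) : ℤ × ℝ) :=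
    Int.measurable_floor.prodMk measurable_id
  have := h.comp h'
  exact this

theorem density_eqOn_Ico (S : OperatorMeasure H) (ρ : Measure ℝ) (f g : H) (n : ℤ) :
    EqOn (S.density ρ f g) ((S.matrixElement n f g).rnDeriv ρ) (Ico (n : ℝ) (n + 1)) := by
  intro t ht
  have : ⌊t⌋ = n := Int.floor_eq_iff.2 ⟨ht.1, ht.2⟩
  simp only [density, this]

theorem integrableOn_density (S : OperatorMeasure H) (ρ : Measure ℝ) (f g : H) (n : ℤ) :
    IntegrableOn (S.density ρ f g) (Ico (n : ℝ) (n + 1)) ρ :=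
  (integrableOn_congr_fun (S.density_eqOn_Ico ρ f g n) measurableSet_Ico).2
    (ComplexMeasure.integrable_rnDeriv _ _).integrableOn

theorem setIntegral_rnDeriv_of_absolutelyContinuous {α : Type*} [MeasurableSpace α]
    {c : ComplexMeasure α} {μ : Measure α} [SigmaFinite μ]
    (hc : ∀ s, MeasurableSet s → μ s = 0 → c s = 0) {s : Set α} (hs : MeasurableSet s) :
    ∫ x in s, c.rnDeriv μ x ∂μ = c s := by
  have hre : μ.withDensityᵥ (c.re.rnDeriv μ) = c.re :=
    SignedMeasure.withDensityᵥ_rnDeriv_eq _ _ <| VectorMeasure.AbsolutelyContinuous.mk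
      fun t ht h0 => by
        rw [Measure.toENNRealVectorMeasure_apply_measurable ht] at h0
        change (c t).re = 0
        rw [hc t ht h0, Complex.zero_re]
  have him : μ.withDensityᵥ (c.im.rnDeriv μ) = c.im :=
    SignedMeasure.withDensityᵥ_rnDeriv_eq _ _ <| VectorMeasure.AbsolutelyContinuous.mk
      fun t ht h0 => by
        rw [Measure.toENNRealVectorMeasure_apply_measurable ht] at h0
        change (c t).im = 0
        rw [hc t ht h0, Complex.zero_im]
  have hi := (c.integrable_rnDeriv μ).integrableOn (s := s)
  apply Complex.ext
  · rw [← RCLike.re_eq_complex_re, ← integral_re hi, RCLike.re_eq_complex_re]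
    refine (withDensityᵥ_apply (SignedMeasure.integrable_rnDeriv c.re μ) hs).symm.trans ?_
    rw [hre]; rfl
  · rw [← RCLike.im_eq_complex_im, ← integral_im hi, RCLike.im_eq_complex_im]
    refine (withDensityᵥ_apply (SignedMeasure.integrable_rnDeriv c.im μ) hs).symm.trans ?_
    rw [him]; rfl

theorem matrixElement_apply (S : OperatorMeasure H) (n : ℤ) (f g : H) {δ : Set ℝ}
    (hδ : MeasurableSet δ) :
    S.matrixElement n f g δ = inner ℂ g (S (δ ∩ Ico (n : ℝ) (n + 1)) f) :=
  if_pos hδ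

section

variable {S : OperatorMeasure H} {ρ : Measure ℝ} [SigmaFinite ρ]

theorem IsEquivalent.setIntegral_density (hS : S.IsEquivalent ρ) (f g : H) (n : ℤ) {δ : Set ℝ}
    (hδ : MeasurableSet δ) :
    ∫ t in δ ∩ Ico (n : ℝ) (n + 1), S.density ρ f g t ∂ρ =
      inner ℂ g (S (δ ∩ Ico (n : ℝ) (n + 1)) f) := by
  have hm : MeasurableSet (δ ∩ Ico (n : ℝ) (n + 1)) := hδ.inter measurableSet_Ico
  rw [setIntegral_congr_fun hm ((S.density_eqOn_Ico ρ f g n).mono inter_subset_right),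
    setIntegral_rnDeriv_of_absolutelyContinuous _ hm, S.matrixElement_apply n f g hm,
    inter_assoc, inter_self]
  intro s hs h0
  rw [S.matrixElement_apply n f g hs, (hS _ (hs.inter measurableSet_Ico)
    ((Metric.isBounded_Ico _ _).subset inter_subset_right)).2
    (measure_mono_null inter_subset_left h0)]
  simp

/-- Uniqueness of densities: each algebraic identity below reduces to comparing integrals over Borel
subsets of unit intervals. -/
theorem IsEquivalent.ae_eq_density (hS : S.IsEquivalent ρ) (f g : H) {φ : ℝ → ℂ}
    (hφ : ∀ n : ℤ, IntegrableOn φ (Ico (n : ℝ) (n + 1)) ρ)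
    (h : ∀ (n : ℤ) (δ : Set ℝ), MeasurableSet δ →
      ∫ t in δ ∩ Ico (n : ℝ) (n + 1), φ t ∂ρ = inner ℂ g (S (δ ∩ Ico (n : ℝ) (n + 1)) f)) :
    φ =ᵐ[ρ] S.density ρ f g := by
  refine ae_of_forall_Ico fun n => ?_
  refine Integrable.ae_eq_of_forall_setIntegral_eq _ _ (hφ n) (S.integrableOn_density ρ f g n) ?_
  intro s hs _
  rw [Measure.restrict_restrict hs, h n s hs, hS.setIntegral_density f g n hs]

theorem IsEquivalent.ae_density_conj (hS : S.IsEquivalent ρ) (f g : H) :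
    ∀ᵐ t ∂ρ, conj (S.density ρ f g t) = S.density ρ g f t := by
  refine hS.ae_eq_density g f (φ := fun t => conj (S.density ρ f g t)) (fun n => ?_)
    fun n δ hδ => ?_
  · exact (Complex.conjCLE.toContinuousLinearMap.integrable_comp (S.integrableOn_density ρ f g n))
  · rw [integral_conj, hS.setIntegral_density f g n hδ, inner_conj_symm]
    exact ((S.isPositive' _ (hδ.inter measurableSet_Ico)
      ((Metric.isBounded_Ico _ _).subset inter_subset_right)).isSymmetric f g)

theorem IsEquivalent.ae_density_sum (hS : S.IsEquivalent ρ) {κ κ' : Type*} [Fintype κ]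
    [Fintype κ'] (v : κ → H) (x : κ → ℂ) (w : κ' → H) (y : κ' → ℂ) :
    ∀ᵐ t ∂ρ, S.density ρ (∑ i, x i • v i) (∑ j, y j • w j) t =
      ∑ i, ∑ j, x i * conj (y j) * S.density ρ (v i) (w j) t := by
  have hi : ∀ n : ℤ, ∀ i ∈ Finset.univ, ∀ j ∈ Finset.univ,
      Integrable (fun t => x i * conj (y j) * S.density ρ (v i) (w j) t)
        (ρ.restrict (Ico (n : ℝ) (n + 1))) := fun n i _ j _ =>
    (S.integrableOn_density ρ (v i) (w j) n).const_mul _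
  refine (hS.ae_eq_density _ _ (fun n => integrable_finsetSum _ fun i hi' =>
    integrable_finsetSum _ fun j hj => hi n i hi' j hj) fun n δ hδ => ?_).symm
  have hi' : ∀ i ∈ Finset.univ, ∀ j ∈ Finset.univ,
      Integrable (fun t => x i * conj (y j) * S.density ρ (v i) (w j) t)
        (ρ.restrict (δ ∩ Ico (n : ℝ) (n + 1))) := fun i h j h' =>
    IntegrableOn.mono_set (hi n i h j h') inter_subset_right
  rw [integral_finsetSum _ fun i h => integrable_finsetSum _ fun j h' => hi' i h j h']
  simp only [map_sum, map_smul, sum_inner, inner_sum, inner_smul_left, inner_smul_right]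
  refine Finset.sum_congr rfl fun i _ => ?_
  rw [integral_finsetSum _ fun j h' => hi' i (Finset.mem_univ _) j h', Finset.mul_sum]
  refine Finset.sum_congr rfl fun j _ => ?_
  rw [integral_const_mul, hS.setIntegral_density _ _ n hδ]
  ring

theorem IsEquivalent.ae_density_self_nonneg (hS : S.IsEquivalent ρ) (f : H) :
    ∀ᵐ t ∂ρ, 0 ≤ S.density ρ f f t := by
  have hre : ∀ᵐ t ∂ρ, 0 ≤ (S.density ρ f f t).re := by
    refine ae_of_forall_Ico fun n => ?_
    refine ae_nonneg_of_forall_setIntegral_nonneg (S.integrableOn_density ρ f f n).re ?_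
    intro s hs _
    have hi : IntegrableOn (S.density ρ f f) (s ∩ Ico (n : ℝ) (n + 1)) ρ :=
      (S.integrableOn_density ρ f f n).mono_set inter_subset_right
    rw [Measure.restrict_restrict hs]
    refine le_of_le_of_eq ?_ (integral_re hi).symm
    rw [hS.setIntegral_density f f n hs]
    exact (S.isPositive' _ (hs.inter measurableSet_Ico)
      ((Metric.isBounded_Ico _ _).subset inter_subset_right)).re_inner_nonneg_right f
  filter_upwards [hre, hS.ae_density_conj f f] with t h1 h2
  exact Complex.nonneg_iff.2 ⟨h1, (Complex.conj_eq_iff_im.1 h2).symm⟩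

end

end OperatorMeasure

/-! ### Density matrices as Gram matrices of fibre vectors -/

theorem Matrix.PosSemidef.exists_eq_gram {κ : Type*} [Fintype κ] {M : Matrix κ κ ℂ}
    (hM : M.PosSemidef) : ∃ w : κ → EuclideanSpace ℂ κ, M = Matrix.gram ℂ w := by
  classical
  open scoped MatrixOrder in
  obtain ⟨B, hB⟩ := CStarAlgebra.nonneg_iff_eq_star_mul_self.1 hM.nonneg
  refine ⟨fun i => WithLp.toLp 2 (fun k => B k i), ?_⟩
  ext i j
  rw [hB, Matrix.gram_apply, PiLp.inner_apply]
  simp [Matrix.mul_apply, mul_comm, Matrix.star_apply]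

theorem Matrix.rank_gram {E κ : Type*} [NormedAddCommGroup E] [InnerProductSpace ℂ E]
    [FiniteDimensional ℂ E] [Fintype κ] (w : κ → E) :
    (Matrix.gram ℂ w).rank = Module.finrank ℂ (Submodule.span ℂ (range w)) := by
  let b := stdOrthonormalBasis ℂ E
  let L := b.repr.toLinearEquiv.trans (WithLp.linearEquiv 2 ℂ (Fin (Module.finrank ℂ E) → ℂ))
  have h := Matrix.gram_eq_conjTranspose_mul b w
  rw [h, Matrix.rank_conjTranspose_mul_self, Matrix.rank_eq_finrank_span_cols]
  have : range (Matrix.of fun i j => b.repr (w j) i).col = L.toLinearMap '' range w := by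
    rw [← range_comp]; rfl
  rw [this, Submodule.span_image]
  exact LinearEquiv.finrank_map_eq L _

namespace OperatorMeasure

variable {H : Type u} [NormedAddCommGroup H] [InnerProductSpace ℂ H]
  {S : OperatorMeasure H} {ρ : Measure ℝ} [SigmaFinite ρ]

/-- The transpose appears because the row index of the density matrix is the linear slot. -/
theorem IsEquivalent.ae_density_sum_self (hS : S.IsEquivalent ρ) {κ : Type*} [Fintype κ]
    (v : κ → H) (x : κ → ℂ) :
    ∀ᵐ t ∂ρ, S.density ρ (∑ i, x i • v i) (∑ i, x i • v i) t =
      dotProduct (star x) (Matrix.mulVec (S.densityMatrix ρ v t).transpose x) := by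
  filter_upwards [hS.ae_density_sum v x v x] with t ht
  rw [ht, Finset.sum_comm]
  simp only [dotProduct, Matrix.mulVec, Finset.mul_sum, Matrix.transpose_apply, densityMatrix,
    Matrix.of_apply, Pi.star_apply]
  refine Finset.sum_congr rfl fun i _ => Finset.sum_congr rfl fun j _ => ?_
  rw [← Complex.star_def]
  ring

/-- The null set for one `x` depends on `x`, so positivity is obtained on a countable dense set of
coefficient vectors and extended by continuity. -/
theorem IsEquivalent.ae_posSemidef (hS : S.IsEquivalent ρ) {κ : Type*} [Fintype κ]
    (v : κ → H) : ∀ᵐ t ∂ρ, (S.densityMatrix ρ v t).transpose.PosSemidef := by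
  have h1 : ∀ᵐ t ∂ρ, ∀ n : ℕ, 0 ≤ dotProduct (star (TopologicalSpace.denseSeq (κ → ℂ) n))
      (Matrix.mulVec (S.densityMatrix ρ v t).transpose (TopologicalSpace.denseSeq (κ → ℂ) n)) := by
    refine ae_all_iff.2 fun n => ?_
    filter_upwards [hS.ae_density_sum_self v (TopologicalSpace.denseSeq (κ → ℂ) n),
      hS.ae_density_self_nonneg (∑ i, TopologicalSpace.denseSeq (κ → ℂ) n i • v i)] with t h h'
    rwa [← h]
  have h2 : ∀ᵐ t ∂ρ, ∀ i j, conj (S.density ρ (v i) (v j) t) = S.density ρ (v j) (v i) t :=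
    ae_all_iff.2 fun i => ae_all_iff.2 fun j => hS.ae_density_conj _ _
  filter_upwards [h1, h2] with t h1 h2
  refine Matrix.PosSemidef.of_dotProduct_mulVec_nonneg (Matrix.ext fun i j => h2 i j) fun x => ?_
  have hc : IsClosed {x : κ → ℂ |
      0 ≤ dotProduct (star x) (Matrix.mulVec (S.densityMatrix ρ v t).transpose x)} := by
    refine isClosed_le continuous_const ?_
    fun_prop
  have hd : Dense {x : κ → ℂ |
      0 ≤ dotProduct (star x) (Matrix.mulVec (S.densityMatrix ρ v t).transpose x)} :=
    (TopologicalSpace.denseRange_denseSeq (κ → ℂ)).mono (range_subset_iff.2 h1)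
  exact hc.closure_subset (hd x)

/-- Almost everywhere, the density matrix is the (transposed) Gram matrix of vectors that satisfy
any given countable set of linear relations satisfied by the original vectors. -/
theorem IsEquivalent.ae_exists_gram (hS : S.IsEquivalent ρ) {κ α : Type*} [Fintype κ]
    [Countable α] (v : κ → H) (c : α → κ → ℂ) (hc : ∀ a, ∑ i, c a i • v i = 0) :
    ∀ᵐ t ∂ρ, ∃ w : κ → EuclideanSpace ℂ κ,
      S.densityMatrix ρ v t = (Matrix.gram ℂ w).transpose ∧ ∀ a, ∑ i, c a i • w i = 0 := by
  have h0 : ∀ᵐ t ∂ρ, S.density ρ (0 : H) 0 t = 0 := by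
    have := hS.ae_density_sum (fun i : Empty => (0 : H)) (fun _ => 0) (fun i : Empty => (0 : H))
      (fun _ => 0)
    simpa using this
  have h1 := ae_all_iff.2 fun a => hS.ae_density_sum_self v (c a)
  filter_upwards [h0, h1, hS.ae_posSemidef v] with t h0 h1 h2
  obtain ⟨w, hw⟩ := h2.exists_eq_gram
  refine ⟨w, by rw [← hw, Matrix.transpose_transpose], fun a => ?_⟩
  -- The quadratic form at `c a` is `‖∑ i, c a i • w i‖ ^ 2`, and it equals the density of the zero
  -- vector.
  have := h1 a
  rw [hc a, h0, hw, Matrix.star_dotProduct_gram_mulVec] at this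
  exact inner_self_eq_zero.1 this.symm

/-- Transport of linear dependence: the vectors representing the densities may be chosen so that
those attached to `f` lie in the span of those attached to `v`, if `f` lies in the span of `v`. -/
theorem IsEquivalent.ae_exists_gram_sum (hS : S.IsEquivalent ρ) {κ κ' : Type*} [Fintype κ]
    [Fintype κ'] (v : κ → H) (f : κ' → H) (hf : ∀ i, f i ∈ Submodule.span ℂ (range v)) :
    ∀ᵐ t ∂ρ, ∃ w : κ ⊕ κ' → EuclideanSpace ℂ (κ ⊕ κ'),
      S.densityMatrix ρ v t = (Matrix.gram ℂ (w ∘ Sum.inl)).transpose ∧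
      S.densityMatrix ρ f t = (Matrix.gram ℂ (w ∘ Sum.inr)).transpose ∧
      ∀ i, w (Sum.inr i) ∈ Submodule.span ℂ (range (w ∘ Sum.inl)) := by
  classical
  have h1 : ∀ i, ∃ c : κ → ℂ, ∑ j, c j • v j = f i := fun i =>
    (Submodule.mem_span_range_iff_exists_fun ℂ).1 (hf i)
  choose c hc using h1
  -- The relation with index `i` is `∑ j, c i j • v j - f i = 0`.
  have := hS.ae_exists_gram (Sum.elim v f)
    (fun i : κ' => Sum.elim (c i) (fun j => if j = i then -1 else 0)) (fun i => by simp [hc])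
  filter_upwards [this] with t ⟨w, hw, hr⟩
  refine ⟨w, ?_, ?_, fun i => ?_⟩
  · ext i j
    exact congr_fun (congr_fun hw (Sum.inl i)) (Sum.inl j)
  · ext i j
    exact congr_fun (congr_fun hw (Sum.inr i)) (Sum.inr j)
  · have := hr i
    simp only [Fintype.sum_sum_type, Sum.elim_inl, Sum.elim_inr, ite_smul, neg_smul, one_smul,
      zero_smul, Finset.sum_ite_eq', Finset.mem_univ, if_true, add_neg_eq_zero] at this
    rw [← this]
    exact Submodule.sum_mem _ fun j _ => Submodule.smul_mem _ _ (Submodule.subset_span ⟨j, rfl⟩)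

theorem IsEquivalent.ae_rank_le (hS : S.IsEquivalent ρ) {κ κ' : Type*} [Fintype κ]
    [Fintype κ'] (v : κ → H) (f : κ' → H) (hf : ∀ i, f i ∈ Submodule.span ℂ (range v)) :
    ∀ᵐ t ∂ρ, (S.densityMatrix ρ f t).rank ≤ (S.densityMatrix ρ v t).rank := by
  filter_upwards [hS.ae_exists_gram_sum v f hf] with t ⟨w, h1, h2, h3⟩
  rw [h1, h2, Matrix.rank_transpose, Matrix.rank_transpose, Matrix.rank_gram, Matrix.rank_gram]
  exact Submodule.finrank_mono (Submodule.span_le.2 (range_subset_iff.2 h3))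

theorem IsEquivalent.ae_exists_gram_pair (hS : S.IsEquivalent ρ) {κ κ' : Type*} [Fintype κ]
    [Fintype κ'] (v : κ → H) (f : κ' → H) :
    ∀ᵐ t ∂ρ, ∃ w : κ ⊕ κ' → EuclideanSpace ℂ (κ ⊕ κ'),
      S.densityMatrix ρ (Sum.elim v f) t = (Matrix.gram ℂ w).transpose := by
  filter_upwards [hS.ae_exists_gram (Sum.elim v f) (fun a : Empty => a.elim) (fun a => a.elim)]
    with t ⟨w, h, _⟩
  exact ⟨w, h⟩

theorem _root_.Matrix.rank_eq_card_iff_det_ne_zero {κ : Type*} [Fintype κ] [DecidableEq κ]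
    (M : Matrix κ κ ℂ) : M.rank = Fintype.card κ ↔ M.det ≠ 0 := by
  constructor
  · intro h
    have h1 := (Matrix.rank_eq_finrank_span_cols M).symm.trans h
    have h2 := (linearIndependent_iff_card_eq_finrank_span (b := M.col)).2 h1.symm
    have h3 := Matrix.linearIndependent_cols_iff_isUnit.1 h2
    exact ((Matrix.isUnit_iff_isUnit_det M).1 h3).ne_zero
  · exact fun h => Matrix.rank_of_isUnit M ((Matrix.isUnit_iff_isUnit_det M).2 h.isUnit)

end OperatorMeasure

/-! ### Continuity in the vectors; multiplicity through minors -/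

namespace OperatorMeasure

variable {H : Type u} [NormedAddCommGroup H] [InnerProductSpace ℂ H]
  {S : OperatorMeasure H} {ρ : Measure ℝ} [SigmaFinite ρ]

/-- Cauchy–Schwarz for the two fibre vectors. -/
theorem IsEquivalent.ae_norm_density_sq_le (hS : S.IsEquivalent ρ) (f g : H) :
    ∀ᵐ t ∂ρ, ‖S.density ρ f g t‖ ^ 2 ≤ ‖S.density ρ f f t‖ * ‖S.density ρ g g t‖ := by
  filter_upwards [hS.ae_exists_gram ![f, g] (fun a : Empty => a.elim) (fun a => a.elim)]
    with t ⟨w, h, _⟩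
  have h' : ∀ i j, S.density ρ (![f, g] i) (![f, g] j) t = inner ℂ (w j) (w i) :=
    fun i j => congr_fun (congr_fun h i) j
  have h00 := h' 0 0
  have h01 := h' 0 1
  have h11 := h' 1 1
  simp only [Matrix.cons_val_zero, Matrix.cons_val_one] at h00 h01 h11
  rw [h00, h01, h11, inner_self_eq_norm_sq_to_K, inner_self_eq_norm_sq_to_K, norm_pow, norm_pow,
    RCLike.norm_ofReal, RCLike.norm_ofReal, abs_norm, abs_norm, ← mul_pow, mul_comm]
  gcongr
  exact norm_inner_le_norm _ _

theorem IsEquivalent.integral_norm_density_self_le (hS : S.IsEquivalent ρ) (f : H) (n : ℤ) :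
    ∫ t in Ico (n : ℝ) (n + 1), ‖S.density ρ f f t‖ ∂ρ ≤
      ‖S (Ico (n : ℝ) (n + 1))‖ * ‖f‖ ^ 2 := by
  have h1 : ∫ t in Ico (n : ℝ) (n + 1), ‖S.density ρ f f t‖ ∂ρ =
      ∫ t in Ico (n : ℝ) (n + 1), RCLike.re (S.density ρ f f t) ∂ρ := by
    refine integral_congr_ae (ae_restrict_of_ae ?_)
    filter_upwards [hS.ae_density_self_nonneg f] with t ht
    obtain ⟨h, h'⟩ := Complex.nonneg_iff.1 ht
    have : S.density ρ f f t = ((S.density ρ f f t).re : ℂ) := Complex.ext rfl h'.symm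
    rw [this, Complex.norm_real, Real.norm_of_nonneg h]
    rfl
  have h2 := hS.setIntegral_density f f n MeasurableSet.univ
  rw [univ_inter] at h2
  rw [h1, integral_re (S.integrableOn_density ρ f f n), h2]
  calc _ ≤ ‖inner ℂ f (S (Ico (n : ℝ) (n + 1)) f)‖ := RCLike.re_le_norm _
    _ ≤ ‖f‖ * ‖S (Ico (n : ℝ) (n + 1)) f‖ := norm_inner_le_norm _ _
    _ ≤ ‖f‖ * (‖S (Ico (n : ℝ) (n + 1))‖ * ‖f‖) := by
      gcongr; exact ContinuousLinearMap.le_opNorm _ _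
    _ = _ := by ring

/-- On a unit interval the `L¹` norms are bounded by a constant times `4⁻ʲ`. They are summable, so
the series of densities is a.e. finite and its terms tend to zero without passing to a subsequence.
-/
theorem IsEquivalent.ae_tendsto_density_self_zero (hS : S.IsEquivalent ρ) {y : ℕ → H}
    (hy : ∀ j, ‖y j‖ ≤ (1 / 2) ^ j) :
    ∀ᵐ t ∂ρ, Tendsto (fun j => ‖S.density ρ (y j) (y j) t‖) atTop (𝓝 0) := by
  refine ae_of_forall_Ico fun n => ?_
  have hm : ∀ j, Measurable fun t => ‖S.density ρ (y j) (y j) t‖ₑ :=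
    fun j => (S.measurable_density ρ _ _).enorm
  have hle : ∀ j, ∫⁻ t in Ico (n : ℝ) (n + 1), ‖S.density ρ (y j) (y j) t‖ₑ ∂ρ ≤
      ENNReal.ofReal (‖S (Ico (n : ℝ) (n + 1))‖ * (1 / 4) ^ j) := fun j => by
    rw [← ofReal_integral_norm_eq_lintegral_enorm (S.integrableOn_density ρ _ _ n)]
    refine ENNReal.ofReal_le_ofReal ((hS.integral_norm_density_self_le _ n).trans ?_)
    gcongr
    calc ‖y j‖ ^ 2 ≤ ((1 / 2) ^ j) ^ 2 := by gcongr; exact hy j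
      _ = (1 / 4) ^ j := by rw [← pow_mul, mul_comm, pow_mul]; norm_num
  have hsum : Summable fun j : ℕ => ‖S (Ico (n : ℝ) (n + 1))‖ * (1 / 4 : ℝ) ^ j :=
    (summable_geometric_of_lt_one (by norm_num) (by norm_num)).mul_left _
  have hfin : ∫⁻ t in Ico (n : ℝ) (n + 1), ∑' j, ‖S.density ρ (y j) (y j) t‖ₑ ∂ρ ≠ ∞ := by
    rw [lintegral_tsum fun j => (hm j).aemeasurable]
    refine ne_top_of_le_ne_top ?_ (ENNReal.tsum_le_tsum hle)
    rw [← ENNReal.ofReal_tsum_of_nonneg (fun j => by positivity) hsum]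
    exact ENNReal.ofReal_ne_top
  filter_upwards [ae_lt_top (Measurable.tsum hm) hfin] with t ht
  have := ENNReal.tendsto_atTop_zero_of_tsum_ne_top ht.ne
  have h2 := (ENNReal.tendsto_toReal ENNReal.zero_ne_top).comp this
  simpa [Function.comp_def] using h2

theorem IsEquivalent.ae_tendsto_density (hS : S.IsEquivalent ρ) {f g : ℕ → H} {f₀ g₀ : H}
    (hf : ∀ j, ‖f j - f₀‖ ≤ (1 / 2) ^ j) (hg : ∀ j, ‖g j - g₀‖ ≤ (1 / 2) ^ j) :
    ∀ᵐ t ∂ρ, Tendsto (fun j => S.density ρ (f j) (g j) t) atTop (𝓝 (S.density ρ f₀ g₀ t)) := by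
  have hexp : ∀ᵐ t ∂ρ, ∀ j, S.density ρ (f j) (g j) t = S.density ρ (f j - f₀) (g j - g₀) t +
      S.density ρ (f j - f₀) g₀ t + S.density ρ f₀ (g j - g₀) t + S.density ρ f₀ g₀ t := by
    refine ae_all_iff.2 fun j => ?_
    filter_upwards [hS.ae_density_sum ![f j - f₀, f₀] ![1, 1] ![g j - g₀, g₀] ![1, 1]] with t ht
    simp only [Fin.sum_univ_two, Matrix.cons_val_zero, Matrix.cons_val_one, one_smul,
      sub_add_cancel, map_one, one_mul] at ht
    rw [ht]; ring
  have h1 := ae_all_iff.2 fun j => hS.ae_norm_density_sq_le (f j - f₀) (g j - g₀)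
  have h2 := ae_all_iff.2 fun j => hS.ae_norm_density_sq_le (f j - f₀) g₀
  have h3 := ae_all_iff.2 fun j => hS.ae_norm_density_sq_le f₀ (g j - g₀)
  filter_upwards [hexp, h1, h2, h3, hS.ae_tendsto_density_self_zero hf,
    hS.ae_tendsto_density_self_zero hg] with t hexp h1 h2 h3 h4 h5
  have key : ∀ {a b : ℕ → ℝ} {z : ℕ → ℂ}, (∀ j, ‖z j‖ ^ 2 ≤ a j * b j) →
      Tendsto (fun j => a j * b j) atTop (𝓝 0) → Tendsto z atTop (𝓝 0) := by
    intro a b z h hab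
    have h' : Tendsto (fun j => ‖z j‖ ^ 2) atTop (𝓝 0) :=
      squeeze_zero (fun j => by positivity) h hab
    rw [tendsto_zero_iff_norm_tendsto_zero]
    simpa using h'.sqrt
  have e1 := key h1 (by simpa using h4.mul h5)
  have e2 := key h2 (by simpa using h4.mul_const _)
  have e3 := key h3 (by simpa using h5.const_mul _)
  simp only [hexp]
  simpa using ((e1.add e2).add e3).add_const (S.density ρ f₀ g₀ t)

theorem IsEquivalent.ae_tendsto_densityMatrix (hS : S.IsEquivalent ρ) {κ : Type*} [Countable κ]
    {f : ℕ → κ → H} {f₀ : κ → H} (hf : ∀ j i, ‖f j i - f₀ i‖ ≤ (1 / 2) ^ j) :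
    ∀ᵐ t ∂ρ, Tendsto (fun j => S.densityMatrix ρ (f j) t) atTop (𝓝 (S.densityMatrix ρ f₀ t)) := by
  have h : ∀ᵐ t ∂ρ, ∀ i i', Tendsto (fun j => S.density ρ (f j i) (f j i') t) atTop
      (𝓝 (S.density ρ (f₀ i) (f₀ i') t)) := ae_all_iff.2 fun i => ae_all_iff.2 fun i' =>
    hS.ae_tendsto_density (fun j => hf j i) (fun j => hf j i')
  filter_upwards [h] with t ht
  exact tendsto_pi_nhds.2 fun i => tendsto_pi_nhds.2 fun i' => ht i i'

theorem IsEquivalent.ae_tendsto_det (hS : S.IsEquivalent ρ) {κ : Type*} [Fintype κ]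
    [DecidableEq κ] {f : ℕ → κ → H} {f₀ : κ → H} (hf : ∀ j i, ‖f j i - f₀ i‖ ≤ (1 / 2) ^ j) :
    ∀ᵐ t ∂ρ, Tendsto (fun j => (S.densityMatrix ρ (f j) t).det) atTop
      (𝓝 (S.densityMatrix ρ f₀ t).det) := by
  filter_upwards [hS.ae_tendsto_densityMatrix hf] with t ht
  exact (continuous_id.matrix_det.tendsto _).comp ht

theorem measurable_det_densityMatrix (S : OperatorMeasure H) (ρ : Measure ℝ) {κ : Type*}
    [Fintype κ] [DecidableEq κ] (f : κ → H) :
    Measurable fun t => (S.densityMatrix ρ f t).det := by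
  simp only [Matrix.det_apply]
  refine Finset.measurable_fun_sum _ fun σ _ => Measurable.const_smul ?_ _
  exact Finset.measurable_fun_prod _ fun i _ => S.measurable_density ρ _ _

theorem multiplicity_eq_rank (S : OperatorMeasure H) (ρ : Measure ℝ) {κ : Type*} [Fintype κ]
    (e : κ → H) (t : ℝ) : S.multiplicity ρ e t = (S.densityMatrix ρ e t).rank := by
  refine le_antisymm (iSup_le fun s => ?_) ?_
  · exact_mod_cast (S.densityMatrix ρ e t).rank_submatrix_le (fun i : s => (i : κ))
      (fun i : s => (i : κ))
  · refine le_iSup_of_le Finset.univ ?_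
    refine Nat.cast_le.2 (le_of_eq ?_)
    let σ : (Finset.univ : Finset κ) ≃ κ := Equiv.subtypeUnivEquiv Finset.mem_univ
    exact ((S.densityMatrix ρ e t).rank_submatrix σ σ).symm

theorem le_multiplicity_iff (S : OperatorMeasure H) (ρ : Measure ℝ) {ι : Type*}
    (e : ι → H) (t : ℝ) (k : ℕ) : (k : ℕ∞) ≤ S.multiplicity ρ e t ↔
      ∃ s : Finset ι, k ≤ (S.densityMatrix ρ (fun i : s => e i) t).rank := by
  constructor
  · intro h
    rcases Nat.eq_zero_or_pos k with rfl | hk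
    · exact ⟨∅, Nat.zero_le _⟩
    -- The supremum may be infinite and not attained, but some member exceeds the finite number `k -
    -- 1`.
    · have : ((k - 1 : ℕ) : ℕ∞) < S.multiplicity ρ e t :=
        lt_of_lt_of_le (Nat.cast_lt.2 (by omega)) h
      obtain ⟨s, hs⟩ := lt_iSup_iff.1 this
      exact ⟨s, by have := Nat.cast_lt.1 hs; omega⟩
  · rintro ⟨s, hs⟩
    exact le_iSup_of_le s (Nat.cast_le.2 hs)

/-- In a matrix of densities of rank at least `k` some principal minor of order `k` does not
vanish. -/
theorem IsEquivalent.ae_exists_det_ne_zero (hS : S.IsEquivalent ρ) {κ : Type*} [Fintype κ]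
    (f : κ → H) : ∀ᵐ t ∂ρ, ∀ k : ℕ, k ≤ (S.densityMatrix ρ f t).rank →
      ∃ a : Fin k → κ, (S.densityMatrix ρ (f ∘ a) t).det ≠ 0 := by
  filter_upwards [hS.ae_exists_gram f (fun a : Empty => a.elim) (fun a => a.elim)]
    with t ⟨w, h, _⟩ k hk
  rw [h, Matrix.rank_transpose, Matrix.rank_gram] at hk
  -- A basis of the span chosen among the fibre vectors; any `k` of its members give a nonzero
  -- principal minor.
  obtain ⟨s, hs, hspan, hli⟩ := exists_linearIndependent ℂ (range w)
  have hsf : s.Finite := (finite_range w).subset hs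
  have := hsf.fintype
  have hcard : k ≤ Fintype.card s := by
    rw [← hspan] at hk
    refine hk.trans_eq ?_
    have := finrank_span_eq_card hli
    rwa [Subtype.range_coe] at this
  obtain ⟨φ⟩ : Nonempty (Fin k ↪ s) := Function.Embedding.nonempty_of_card_le (by rwa [Fintype.card_fin])
  have hex : ∀ i, ∃ j, w j = φ i := fun i => hs (φ i).2
  choose a ha using hex
  refine ⟨a, ?_⟩
  have hg : S.densityMatrix ρ (f ∘ a) t = (Matrix.gram ℂ (w ∘ a)).transpose := by
    ext i j
    exact congr_fun (congr_fun h (a i)) (a j)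
  rw [hg, Matrix.det_transpose, Matrix.det_gram_ne_zero_iff_linearIndependent]
  have : w ∘ a = (fun x : s => (x : EuclideanSpace ℂ κ)) ∘ φ := funext ha
  rw [this]
  exact hli.comp _ φ.injective

/-- Finite combinations of `b` approximate `f` geometrically fast, and a nonzero determinant
survives for some approximant. One finite index set per `j` is used, so `ι` may be uncountable here.
-/
theorem IsEquivalent.ae_le_multiplicity_of_det_ne_zero (hS : S.IsEquivalent ρ) {ι : Type*}
    {b : ι → H} (hb : Dense (Submodule.span ℂ (range b) : Set H)) {k : ℕ} (f : Fin k → H) :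
    ∀ᵐ t ∂ρ, (S.densityMatrix ρ f t).det ≠ 0 → (k : ℕ∞) ≤ S.multiplicity ρ b t := by
  classical
  have hg : ∀ (j : ℕ) (i : Fin k), ∃ g ∈ Submodule.span ℂ (range b), ‖g - f i‖ ≤ (1 / 2) ^ j := by
    intro j i
    obtain ⟨g, hg, hd⟩ := Metric.mem_closure_iff.1 (hb (f i)) ((1 / 2) ^ j) (by positivity)
    exact ⟨g, hg, by rw [← dist_eq_norm, dist_comm]; exact hd.le⟩
  choose g hg hd using hg
  have hs : ∀ (j : ℕ) (i : Fin k), ∃ s : Finset ι, g j i ∈ Submodule.span ℂ (b '' s) := by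
    intro j i
    have := hg j i
    rw [← image_univ, Finsupp.mem_span_image_iff_linearCombination] at this
    obtain ⟨l, _, hl⟩ := this
    refine ⟨l.support, ?_⟩
    rw [Finsupp.mem_span_image_iff_linearCombination]
    exact ⟨l, by simp [Finsupp.mem_supported], hl⟩
  choose s hs using hs
  have hr : ∀ᵐ t ∂ρ, ∀ j, (S.densityMatrix ρ (g j) t).rank ≤
      (S.densityMatrix ρ (fun i : (Finset.univ.biUnion (s j) : Finset ι) => b i) t).rank := by
    refine ae_all_iff.2 fun j => hS.ae_rank_le _ _ fun i => ?_
    refine Submodule.span_mono ?_ (hs j i)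
    rintro _ ⟨x, hx, rfl⟩
    exact ⟨⟨x, Finset.mem_biUnion.2 ⟨i, Finset.mem_univ _, hx⟩⟩, rfl⟩
  filter_upwards [hr, hS.ae_tendsto_det hd] with t hr ht h0
  obtain ⟨j, hj⟩ := (ht.eventually_ne h0).exists
  refine (S.le_multiplicity_iff ρ b t k).2 ⟨_, le_trans ?_ (hr j)⟩
  rw [(Matrix.rank_eq_card_iff_det_ne_zero _).2 hj, Fintype.card_fin]

theorem IsEquivalent.ae_rank_le_multiplicity (hS : S.IsEquivalent ρ) {ι : Type*}
    {b : ι → H} (hb : Dense (Submodule.span ℂ (range b) : Set H)) {κ : Type*} [Fintype κ]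
    (f : κ → H) :
    ∀ᵐ t ∂ρ, ((S.densityMatrix ρ f t).rank : ℕ∞) ≤ S.multiplicity ρ b t := by
  have h : ∀ᵐ t ∂ρ, ∀ (k : ℕ) (a : Fin k → κ), (S.densityMatrix ρ (f ∘ a) t).det ≠ 0 →
      (k : ℕ∞) ≤ S.multiplicity ρ b t := ae_all_iff.2 fun k => ae_all_iff.2 fun a =>
    hS.ae_le_multiplicity_of_det_ne_zero hb (f ∘ a)
  filter_upwards [h, hS.ae_exists_det_ne_zero f] with t h h'
  obtain ⟨a, ha⟩ := h' _ le_rfl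
  exact h _ a ha

end OperatorMeasure

/-! ### Generic extension of a finite family: the Baire argument -/

namespace OperatorMeasure

/-- Reduces the enlarged determinant to the position of one new fibre vector relative to a fixed
span. -/
theorem det_snoc_ne_zero_iff {H : Type*} [NormedAddCommGroup H] [InnerProductSpace ℂ H]
    {S : OperatorMeasure H} {ρ : Measure ℝ} {κ : Type*} {E : Type*} [NormedAddCommGroup E]
    [InnerProductSpace ℂ E] {k : ℕ} {e : Fin k → H} {f : κ → H} {t : ℝ} {w : Fin k ⊕ κ → E}
    (hw : S.densityMatrix ρ (Sum.elim e f) t = (Matrix.gram ℂ w).transpose) (i : κ) :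
    (S.densityMatrix ρ (Fin.snoc e (f i) : Fin (k + 1) → H) t).det ≠ 0 ↔
      LinearIndependent ℂ (w ∘ Sum.inl) ∧
        w (Sum.inr i) ∉ Submodule.span ℂ (range (w ∘ Sum.inl)) := by
  have h : S.densityMatrix ρ (Fin.snoc e (f i) : Fin (k + 1) → H) t =
      (Matrix.gram ℂ (Fin.snoc (w ∘ Sum.inl) (w (Sum.inr i)) : Fin (k + 1) → E)).transpose := by
    ext a a'
    refine Fin.lastCases ?_ (fun a => ?_) a <;> refine Fin.lastCases ?_ (fun a' => ?_) a'
    · simpa [densityMatrix] using congr_fun (congr_fun hw (Sum.inr i)) (Sum.inr i)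
    · simpa [densityMatrix] using congr_fun (congr_fun hw (Sum.inr i)) (Sum.inl a')
    · simpa [densityMatrix] using congr_fun (congr_fun hw (Sum.inl a)) (Sum.inr i)
    · simpa [densityMatrix] using congr_fun (congr_fun hw (Sum.inl a)) (Sum.inl a')
  rw [h, Matrix.det_transpose, Matrix.det_gram_ne_zero_iff_linearIndependent,
    linearIndependent_finSnoc]

theorem norm_snoc_sub_snoc_le {E : Type*} [NormedAddCommGroup E] {k : ℕ} (e : Fin k → E) {x y : E} {r : ℝ} (hr : 0 ≤ r)
    (h : ‖x - y‖ ≤ r) (i : Fin (k + 1)) :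
    ‖(Fin.snoc e x : Fin (k + 1) → E) i - (Fin.snoc e y : Fin (k + 1) → E) i‖ ≤ r := by
  refine Fin.lastCases ?_ (fun i => ?_) i <;> simp [h, hr]

variable {H : Type u} [NormedAddCommGroup H] [InnerProductSpace ℂ H]
  {S : OperatorMeasure H} {ρ : Measure ℝ} [SigmaFinite ρ]

/-- If the fibre vectors of `x + s • y` and `x + s' • y` both lie in the span of the old ones, so
does that of `y`, being their difference divided by `s - s'`. -/
theorem IsEquivalent.ae_det_snoc_eq_zero (hS : S.IsEquivalent ρ) {k : ℕ} (e : Fin k → H)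
    (x y : H) {s s' : ℂ} (hs : s ≠ s') :
    ∀ᵐ t ∂ρ, (S.densityMatrix ρ (Fin.snoc e (x + s • y) : Fin (k + 1) → H) t).det = 0 →
      (S.densityMatrix ρ (Fin.snoc e (x + s' • y) : Fin (k + 1) → H) t).det = 0 →
      (S.densityMatrix ρ (Fin.snoc e y : Fin (k + 1) → H) t).det = 0 := by
  have := hS.ae_exists_gram (Sum.elim e ![x + s • y, x + s' • y, y])
    (fun _ : Unit => Sum.elim 0 ![1, -1, -(s - s')]) (fun _ => by
      simp [Fin.sum_univ_three]; module)
  filter_upwards [this] with t ⟨w, hw, hr⟩ h1 h2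
  have hr := hr ()
  simp only [Fintype.sum_sum_type, Sum.elim_inl, Pi.zero_apply, zero_smul, Finset.sum_const_zero,
    Sum.elim_inr, Fin.sum_univ_three, Matrix.cons_val_zero, Matrix.cons_val_one, Matrix.cons_val,
    one_smul, neg_smul, zero_add] at hr
  by_contra h3
  obtain ⟨hli, h3⟩ := (det_snoc_ne_zero_iff hw 2).1 h3
  have m0 : w (Sum.inr 0) ∈ Submodule.span ℂ (range (w ∘ Sum.inl)) := by
    by_contra h
    exact (det_snoc_ne_zero_iff hw 0).2 ⟨hli, h⟩ h1
  have m1 : w (Sum.inr 1) ∈ Submodule.span ℂ (range (w ∘ Sum.inl)) := by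
    by_contra h
    exact (det_snoc_ne_zero_iff hw 1).2 ⟨hli, h⟩ h2
  refine h3 ((Submodule.smul_mem_iff _ (sub_ne_zero.2 hs)).1 ?_)
  have : (s - s') • w (Sum.inr 2) = w (Sum.inr 0) - w (Sum.inr 1) := by
    rw [← sub_eq_zero, ← neg_eq_zero, ← hr]; abel
  rw [this]
  exact Submodule.sub_mem _ m0 m1

/-- The complement is closed: if `z j → x` fast and every failure set has measure at least `c`, so
does their limsup, `ρ` being finite; there the determinant vanishes for infinitely many `z j`, hence
at `x`. -/
theorem IsEquivalent.isOpen_setOf_measure_lt (hS : S.IsEquivalent ρ) [IsFiniteMeasure ρ]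
    {k : ℕ} (e : Fin k → H) (y : H) (c : ℝ≥0∞) :
    IsOpen {x : H | ρ {t | (S.densityMatrix ρ (Fin.snoc e y : Fin (k + 1) → H) t).det ≠ 0 ∧
      (S.densityMatrix ρ (Fin.snoc e x : Fin (k + 1) → H) t).det = 0} < c} := by
  set Q : H → ℝ → ℂ := fun x t => (S.densityMatrix ρ (Fin.snoc e x : Fin (k + 1) → H) t).det
  have hQ : ∀ x, Measurable (Q x) := fun x => S.measurable_det_densityMatrix ρ _
  rw [← isClosed_compl_iff, ← closure_subset_iff_isClosed]
  intro x hx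
  have h : ∀ j : ℕ, ∃ z : H, c ≤ ρ {t | Q y t ≠ 0 ∧ Q z t = 0} ∧ ‖z - x‖ ≤ (1 / 2) ^ j := by
    intro j
    obtain ⟨z, hz, hd⟩ := Metric.mem_closure_iff.1 hx ((1 / 2) ^ j) (by positivity)
    exact ⟨z, not_lt.1 hz, by rw [← dist_eq_norm, dist_comm]; exact hd.le⟩
  choose z hz hzx using h
  change ¬ ρ {t | Q y t ≠ 0 ∧ Q x t = 0} < c
  refine not_lt.2 ?_
  have hm : ∀ x, MeasurableSet {t | Q y t ≠ 0 ∧ Q x t = 0} := fun x =>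
    ((hQ y) (measurableSet_singleton 0).compl).inter ((hQ x) (measurableSet_singleton 0))
  have hlim : c ≤ ρ (limsup (fun j => {t | Q y t ≠ 0 ∧ Q (z j) t = 0}) atTop) := by
    rw [limsup_eq_iInf_iSup_of_nat]
    simp only [iInf_eq_iInter, iSup_eq_iUnion]
    have hanti : Antitone fun n : ℕ => ⋃ i, ⋃ (_ : i ≥ n), {t | Q y t ≠ 0 ∧ Q (z i) t = 0} :=
      fun a b hab => biUnion_subset_biUnion_left fun i (hi : i ≥ b) => le_trans hab hi
    rw [hanti.measure_iInter
      (fun n => (MeasurableSet.iUnion fun i => MeasurableSet.iUnion fun _ => hm _).nullMeasurableSet)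
      ⟨0, measure_ne_top _ _⟩]
    exact le_iInf fun n => (hz n).trans (measure_mono
      (subset_biUnion_of_mem (u := fun i => {t | Q y t ≠ 0 ∧ Q (z i) t = 0}) (le_refl n)))
  refine hlim.trans (measure_mono_ae ?_)
  filter_upwards [hS.ae_tendsto_det (f := fun j => Fin.snoc e (z j)) (f₀ := Fin.snoc e x)
    fun j i => norm_snoc_sub_snoc_le e (by positivity) (hzx j) i] with t ht hmem
  have hfr : ∃ᶠ j in atTop, Q y t ≠ 0 ∧ Q (z j) t = 0 := mem_limsup_iff_frequently_mem.1 hmem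
  obtain ⟨j, hj⟩ := hfr.exists
  refine ⟨hj.1, ?_⟩
  by_contra h0
  have := (ht.eventually_ne h0)
  obtain ⟨i, hi, hi'⟩ := (hfr.and_eventually this).exists
  exact hi' hi.2

/-- Along `x + s j • y` with `s j → 0` the failure sets are a.e. disjoint, and a finite measure
allows only finitely many of measure at least `c`. -/
theorem IsEquivalent.dense_setOf_measure_lt (hS : S.IsEquivalent ρ) [IsFiniteMeasure ρ]
    {k : ℕ} (e : Fin k → H) (y : H) {c : ℝ≥0∞} (hc : 0 < c) :
    Dense {x : H | ρ {t | (S.densityMatrix ρ (Fin.snoc e y : Fin (k + 1) → H) t).det ≠ 0 ∧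
      (S.densityMatrix ρ (Fin.snoc e x : Fin (k + 1) → H) t).det = 0} < c} := by
  set Q : H → ℝ → ℂ := fun x t => (S.densityMatrix ρ (Fin.snoc e x : Fin (k + 1) → H) t).det
  have hQ : ∀ x, Measurable (Q x) := fun x => S.measurable_det_densityMatrix ρ _
  have hm : ∀ x, MeasurableSet {t | Q y t ≠ 0 ∧ Q x t = 0} := fun x =>
    ((hQ y) (measurableSet_singleton 0).compl).inter ((hQ x) (measurableSet_singleton 0))
  intro x
  let s : ℕ → ℂ := fun j => ((1 / ((j : ℝ) + 1) : ℝ) : ℂ)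
  have hs : Tendsto s atTop (𝓝 0) := by
    have := (Complex.continuous_ofReal.tendsto 0).comp
      (tendsto_one_div_add_atTop_nhds_zero_nat (𝕜 := ℝ))
    simpa [Function.comp_def, s] using this
  have hinj : Function.Injective s := by
    intro i j hij
    have : (1 / ((i : ℝ) + 1) : ℝ) = 1 / ((j : ℝ) + 1) := Complex.ofReal_injective hij
    field_simp at this
    exact_mod_cast (add_right_cancel this).symm
  have hfin := Measure.finite_const_le_meas_of_disjoint_iUnion₀ ρ hc
    (As := fun j => {t | Q y t ≠ 0 ∧ Q (x + s j • y) t = 0})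
    (fun j => (hm _).nullMeasurableSet) (fun i j hij => by
      refine measure_mono_null (fun t ht => ?_)
        (ae_iff.1 (hS.ae_det_snoc_eq_zero e x y (hinj.ne hij)))
      exact fun h => ht.1.1 (h ht.1.2 ht.2.2)) (measure_ne_top _ _)
  have hev : ∀ᶠ j in atTop, ρ {t | Q y t ≠ 0 ∧ Q (x + s j • y) t = 0} < c := by
    have := hfin.eventually_cofinite_notMem
    rw [Nat.cofinite_eq_atTop] at this
    filter_upwards [this] with j hj using not_le.1 hj
  have htend : Tendsto (fun j => x + s j • y) atTop (𝓝 x) := by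
    simpa using (hs.smul_const y).const_add x
  exact mem_closure_of_tendsto htend hev

theorem IsEquivalent.exists_snoc_det_ne_zero [CompleteSpace H] [TopologicalSpace.SeparableSpace H]
    (hS : S.IsEquivalent ρ) [IsFiniteMeasure ρ] {k : ℕ} (e : Fin k → H) :
    ∃ x : H, ∀ y : H, ∀ᵐ t ∂ρ,
      (S.densityMatrix ρ (Fin.snoc e y : Fin (k + 1) → H) t).det ≠ 0 →
      (S.densityMatrix ρ (Fin.snoc e x : Fin (k + 1) → H) t).det ≠ 0 := by
  let d := TopologicalSpace.denseSeq H
  obtain ⟨x, hx⟩ := (dense_iInter_of_isOpen (fun p : ℕ × ℕ =>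
    hS.isOpen_setOf_measure_lt e (d p.1) ((p.2 : ℝ≥0∞) + 1)⁻¹) fun p =>
    hS.dense_setOf_measure_lt e (d p.1) (ENNReal.inv_pos.2 (by finiteness))).nonempty
  have hd : ∀ᵐ t ∂ρ, ∀ i, (S.densityMatrix ρ (Fin.snoc e (d i) : Fin (k + 1) → H) t).det ≠ 0 →
      (S.densityMatrix ρ (Fin.snoc e x : Fin (k + 1) → H) t).det ≠ 0 := by
    refine ae_all_iff.2 fun i => ?_
    rw [ae_iff]
    simp only [Classical.not_imp, not_not]
    refine le_antisymm (le_of_forall_gt fun c hc => ?_) zero_le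
    obtain ⟨m, hm⟩ := ENNReal.exists_inv_nat_lt hc.ne'
    refine (mem_iInter.1 hx (i, m)).trans_le (le_trans ?_ hm.le)
    exact ENNReal.inv_le_inv.2 le_self_add
  refine ⟨x, fun y => ?_⟩
  have hy : ∀ j : ℕ, ∃ i, ‖d i - y‖ ≤ (1 / 2) ^ j := fun j => by
    obtain ⟨i, hi⟩ := (TopologicalSpace.denseRange_denseSeq H).exists_dist_lt y
      (show (0 : ℝ) < (1 / 2) ^ j by positivity)
    exact ⟨i, by rw [← dist_eq_norm, dist_comm]; exact hi.le⟩
  choose i hi using hy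
  filter_upwards [hd, hS.ae_tendsto_det (f := fun j => Fin.snoc e (d (i j)))
    (f₀ := Fin.snoc e y) fun j l => norm_snoc_sub_snoc_le e (by positivity) (hi j) l]
    with t hd ht h0
  obtain ⟨j, hj⟩ := (ht.eventually_ne h0).exists
  exact hd _ hj

end OperatorMeasure

/-! ### Recursion on the whole history; countability of orthonormal families -/

theorem exists_seq_of_forall_fin {α : Type*} (next : ∀ k : ℕ, (Fin k → α) → α) :
    ∃ e : ℕ → α, ∀ k, e k = next k fun i => e i := by
  let F : ∀ k : ℕ, Fin k → α :=
    Nat.rec Fin.elim0 fun k f => (Fin.snoc f (next k f) : Fin (k + 1) → α)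
  have hF : ∀ k, F k = fun i : Fin k => next i (F i) := by
    intro k
    induction k with
    | zero => exact funext fun i => i.elim0
    | succ k ih =>
      funext i
      refine Fin.lastCases ?_ (fun i => ?_) i
      · exact Fin.snoc_last (α := fun _ => α) _ _
      · exact (Fin.snoc_castSucc (α := fun _ => α) _ _ i).trans (congr_fun ih i)
  exact ⟨fun k => next k (F k), fun k => congr_arg (next k) (hF k)⟩

theorem Fin.snoc_restrict {α : Type*} (e : ℕ → α) (k : ℕ) :
    (Fin.snoc (fun i : Fin k => e i) (e k) : Fin (k + 1) → α) = fun i : Fin (k + 1) => e i := by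
  funext i
  refine Fin.lastCases ?_ (fun i => ?_) i <;> simp

theorem Orthonormal.countable {E ι : Type*} [NormedAddCommGroup E] [InnerProductSpace ℂ E]
    [TopologicalSpace.SeparableSpace E] {v : ι → E} (hv : Orthonormal ℂ v) : Countable ι := by
  have hd : ∀ i j, i ≠ j → 1 ≤ dist (v i) (v j) := by
    intro i j hij
    have h := hv.inner_eq_zero hij
    have h2 := norm_sub_sq (𝕜 := ℂ) (v i) (v j)
    rw [h, hv.norm_eq_one, hv.norm_eq_one] at h2
    simp only [map_zero] at h2
    rw [dist_eq_norm]
    nlinarith [norm_nonneg (v i - v j)]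
  refine Pairwise.countable_of_isOpen_disjoint (s := fun i => Metric.ball (v i) (1 / 2)) ?_
    (fun i => Metric.isOpen_ball) (fun i => ⟨v i, Metric.mem_ball_self (by norm_num)⟩)
  intro i j hij
  exact Metric.ball_disjoint_ball (by linarith [hd i j hij])

/-! ### Change of the scalar measure and the greedy sequence -/

namespace OperatorMeasure

variable {H : Type u} [NormedAddCommGroup H] [InnerProductSpace ℂ H]
  {S : OperatorMeasure H} {ρ : Measure ℝ}

/-- Equivalence speaks only of bounded sets, so a null set is cut along unit intervals. -/
theorem IsEquivalent.absolutelyContinuous {ρ' : Measure ℝ} (hS : S.IsEquivalent ρ)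
    (hS' : S.IsEquivalent ρ') : ρ ≪ ρ' := by
  refine Measure.AbsolutelyContinuous.mk fun s hs h0 => ?_
  have : ∀ᵐ t ∂ρ, t ∉ s := by
    refine ae_of_forall_Ico fun n => ?_
    rw [ae_restrict_iff' measurableSet_Ico, ae_iff]
    have hb : Bornology.IsBounded (s ∩ Ico (n : ℝ) (n + 1)) :=
      (Metric.isBounded_Ico _ _).subset inter_subset_right
    have hm := hs.inter (measurableSet_Ico (a := (n : ℝ)) (b := n + 1))
    have h1 := (hS _ hm hb).1 ((hS' _ hm hb).2 (measure_mono_null inter_subset_left h0))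
    refine measure_mono_null (fun t ht => ?_) h1
    obtain ⟨h1, h2⟩ := Classical.not_imp.1 ht
    exact ⟨not_not.1 h2, h1⟩
  simpa [ae_iff] using this

theorem IsEquivalent.ae_density_eq_rnDeriv_smul {ρ' : Measure ℝ} [SigmaFinite ρ] [SigmaFinite ρ']
    (hS : S.IsEquivalent ρ) (hS' : S.IsEquivalent ρ') (f g : H) :
    ∀ᵐ t ∂ρ', (ρ.rnDeriv ρ' t).toReal • S.density ρ f g t = S.density ρ' f g t := by
  have hac := hS.absolutelyContinuous hS'
  refine hS'.ae_eq_density f g (fun n => ?_) fun n δ hδ => ?_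
  · rw [← integrable_indicator_iff measurableSet_Ico]
    have h := (integrable_indicator_iff measurableSet_Ico).2 (S.integrableOn_density ρ f g n)
    refine (integrable_congr (ae_of_all _ fun t => ?_)).1 ((integrable_rnDeriv_smul_iff hac).2 h)
    by_cases ht : t ∈ Ico (n : ℝ) (n + 1) <;> simp [ht]
  · rw [setIntegral_rnDeriv_smul hac (hδ.inter measurableSet_Ico),
      hS.setIntegral_density f g n hδ]

/-- The two matrices differ by the factor `ρ.rnDeriv ρ'`, a.e. positive and finite. This makes one
chain serve all `ρ`. -/
theorem IsEquivalent.ae_det_ne_zero_iff {ρ' : Measure ℝ} [SigmaFinite ρ] [SigmaFinite ρ']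
    (hS : S.IsEquivalent ρ) (hS' : S.IsEquivalent ρ') {κ : Type*} [Fintype κ] [DecidableEq κ]
    (f : κ → H) :
    ∀ᵐ t ∂ρ', (S.densityMatrix ρ f t).det ≠ 0 ↔ (S.densityMatrix ρ' f t).det ≠ 0 := by
  have h1 : ∀ᵐ t ∂ρ', ∀ i j,
      (ρ.rnDeriv ρ' t).toReal • S.density ρ (f i) (f j) t = S.density ρ' (f i) (f j) t :=
    ae_all_iff.2 fun i => ae_all_iff.2 fun j => hS.ae_density_eq_rnDeriv_smul hS' _ _
  have h2 : ∀ᵐ t ∂ρ', 0 < ρ.rnDeriv ρ' t := (hS'.absolutelyContinuous hS).ae_le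
    (Measure.rnDeriv_pos (hS.absolutelyContinuous hS'))
  filter_upwards [h1, h2, ρ.rnDeriv_lt_top ρ'] with t h1 h2 h3
  have h4 : ((ρ.rnDeriv ρ' t).toReal : ℂ) ≠ 0 :=
    Complex.ofReal_ne_zero.2 (ENNReal.toReal_pos h2.ne' h3.ne).ne'
  have : S.densityMatrix ρ' f t = ((ρ.rnDeriv ρ' t).toReal : ℂ) • S.densityMatrix ρ f t := by
    ext i j
    exact (h1 i j).symm
  rw [this, Matrix.det_smul]
  simp [h4]

/-- `μ_h` vanishes on bounded pieces of the zero set of its density; by maximality so does `S`,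
hence `ρ`. -/
theorem IsEquivalent.ae_density_self_ne_zero [SigmaFinite ρ] (hS : S.IsEquivalent ρ) {h : H}
    (hh : h ∈ S.maximalVectors) : ∀ᵐ t ∂ρ, S.density ρ h h t ≠ 0 := by
  refine ae_of_forall_Ico fun n => ?_
  rw [ae_restrict_iff' measurableSet_Ico, ae_iff]
  set δ := {t | S.density ρ h h t = 0}
  have hδ : MeasurableSet δ := S.measurable_density ρ h h (measurableSet_singleton 0)
  have hb : Bornology.IsBounded (δ ∩ Ico (n : ℝ) (n + 1)) :=
    (Metric.isBounded_Ico _ _).subset inter_subset_right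
  have hm := hδ.inter (measurableSet_Ico (a := (n : ℝ)) (b := n + 1))
  have h0 : inner ℂ h (S (δ ∩ Ico (n : ℝ) (n + 1)) h) = 0 := by
    rw [← hS.setIntegral_density h h n hδ]
    exact setIntegral_eq_zero_of_forall_eq_zero fun t ht => ht.1
  have h1 := (hS _ hm hb).1 ((hh _ hm hb).2 h0)
  refine measure_mono_null (fun t ht => ?_) h1
  obtain ⟨h1, h2⟩ := Classical.not_imp.1 ht
  exact ⟨not_not.1 h2, h1⟩

/-- The maximality property of a sequence of vectors from which Hellinger chains are built. -/
theorem IsEquivalent.ae_det_ne_zero_of_le_rank [SigmaFinite ρ] (hS : S.IsEquivalent ρ) {e : ℕ → H}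
    (he : ∀ (k : ℕ) (y : H), ∀ᵐ t ∂ρ,
      (S.densityMatrix ρ (Fin.snoc (fun i : Fin k => e i) y : Fin (k + 1) → H) t).det ≠ 0 →
      (S.densityMatrix ρ (fun i : Fin (k + 1) => e i) t).det ≠ 0)
    {κ : Type*} [Fintype κ] (v : κ → H) (k : ℕ) :
    ∀ᵐ t ∂ρ, k ≤ (S.densityMatrix ρ v t).rank →
      (S.densityMatrix ρ (fun i : Fin k => e i) t).det ≠ 0 := by
  induction k with
  | zero => exact ae_of_all _ fun t _ => by simp
  | succ k ih =>
    filter_upwards [ih, ae_all_iff.2 fun a => he k (v a),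
      hS.ae_exists_gram_pair (fun i : Fin k => e i) v] with t ih he ⟨w, hw⟩ hk
    have h1 := ih (by omega)
    have hl : S.densityMatrix ρ (fun i : Fin k => e i) t =
        (Matrix.gram ℂ (w ∘ Sum.inl)).transpose := by
      ext i j
      exact congr_fun (congr_fun hw (Sum.inl i)) (Sum.inl j)
    have hr : S.densityMatrix ρ v t = (Matrix.gram ℂ (w ∘ Sum.inr)).transpose := by
      ext i j
      exact congr_fun (congr_fun hw (Sum.inr i)) (Sum.inr j)
    rw [hl, Matrix.det_transpose, Matrix.det_gram_ne_zero_iff_linearIndependent] at h1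
    rw [hr, Matrix.rank_transpose, Matrix.rank_gram] at hk
    -- Exchange: otherwise a span of dimension at least `k + 1` would lie in one of dimension `k`.
    have hex : ∃ a, w (Sum.inr a) ∉ Submodule.span ℂ (range (w ∘ Sum.inl)) := by
      by_contra! h
      have := Submodule.finrank_mono (R := ℂ) (Submodule.span_le.2 (range_subset_iff.2 h))
      rw [finrank_span_eq_card h1, Fintype.card_fin] at this
      exact absurd (hk.trans this) (by omega)
    obtain ⟨a, ha⟩ := hex
    exact he a ((det_snoc_ne_zero_iff hw a).2 ⟨h1, ha⟩)

theorem exists_seq_det_ne_zero [CompleteSpace H] [TopologicalSpace.SeparableSpace H]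
    (S : OperatorMeasure H) {h : H} (hh : h ∈ S.maximalVectors) :
    ∃ e : ℕ → H, e 0 = h ∧ ∀ (ρ : Measure ℝ) [SigmaFinite ρ], S.IsEquivalent ρ →
      ∀ (k : ℕ) (y : H), ∀ᵐ t ∂ρ,
        (S.densityMatrix ρ (Fin.snoc (fun i : Fin k => e i) y : Fin (k + 1) → H) t).det ≠ 0 →
        (S.densityMatrix ρ (fun i : Fin (k + 1) => e i) t).det ≠ 0 := by
  by_cases hex : ∃ ρ : Measure ℝ, SigmaFinite ρ ∧ S.IsEquivalent ρ
  swap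
  · exact ⟨fun _ => h, rfl, fun ρ hρ hS => (hex ⟨ρ, hρ, hS⟩).elim⟩
  obtain ⟨ρ₁, hρ₁, hS₁⟩ := hex
  let ρ₀ := ρ₁.toFinite
  have hS₀ : S.IsEquivalent ρ₀ := fun δ hm hb =>
    (hS₁ δ hm hb).trans toFinite_apply_eq_zero_iff.symm
  choose next hnext using fun (k : ℕ) (e : Fin k → H) => hS₀.exists_snoc_det_ne_zero e
  -- Index `0` is reserved for `h`: its density is a.e. nonzero, so no competitor does better.
  obtain ⟨e, he⟩ := exists_seq_of_forall_fin fun k (f : Fin k → H) =>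
    if k = 0 then h else next k f
  have he0 : e 0 = h := by simpa using he 0
  refine ⟨e, he0, fun ρ hρ hS k y => ?_⟩
  rcases Nat.eq_zero_or_pos k with rfl | hk
  · filter_upwards [hS.ae_density_self_ne_zero hh] with t ht _
    rw [Matrix.det_fin_one]
    simpa [densityMatrix, he0] using ht
  · have hek : e k = next k fun i => e i := by simpa [hk.ne'] using he k
    have h1 := hnext k (fun i => e i) y
    rw [← hek, Fin.snoc_restrict] at h1
    filter_upwards [(hS.absolutelyContinuous hS₀).ae_le h1,
      hS₀.ae_det_ne_zero_iff hS (Fin.snoc (fun i : Fin k => e i) y : Fin (k + 1) → H),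
      hS₀.ae_det_ne_zero_iff hS (fun i : Fin (k + 1) => e i)] with t h1 h2 h3
    rwa [h2, h3] at h1

/-! ### Hellinger supports, compressions and the determinant criterion -/

section

variable {ι : Type v} {b : ι → H}

/-- Used to force `dim H_k = k`: a nonzero `det Ψ_k` on a non-null set is impossible in smaller
dimension. -/
theorem not_ae_notMem_hellingerSupport {k : ℕ} (hk : 1 ≤ k)
    (hm : (k : ℕ∞) ≤ S.totalMultiplicity ρ b) : ¬ ∀ᵐ t ∂ρ, t ∉ S.hellingerSupport ρ b k := by
  intro h
  have : S.totalMultiplicity ρ b ≤ ((k - 1 : ℕ) : ℕ∞) := by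
    refine essSup_le_of_ae_le _ ?_
    filter_upwards [h] with t ht
    have ht : S.multiplicity ρ b t < (k : ℕ∞) := not_le.1 ht
    refine Order.le_of_lt_succ (ht.trans_eq ?_)
    rw [Order.succ_eq_add_one]
    norm_cast
    omega
  have := hm.trans this
  rw [Nat.cast_le] at this
  omega

theorem density_compress (S : OperatorMeasure H) (ρ : Measure ℝ) (L : Submodule ℂ H)
    [L.HasOrthogonalProjection] (x y : L) :
    (S.compress L).density ρ x y = S.density ρ (x : H) (y : H) := by
  have h : ∀ n, (S.compress L).matrixElement n x y = S.matrixElement n (x : H) (y : H) := by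
    intro n
    ext δ hδ
    rw [matrixElement_apply _ _ _ _ hδ, matrixElement_apply _ _ _ _ hδ]
    exact Submodule.inner_orthogonalProjectionOnto_eq_of_mem_left _ _
  funext t
  simp only [density, h]

theorem hellingerSupport_compress (S : OperatorMeasure H) (ρ : Measure ℝ) (L : Submodule ℂ H)
    [L.HasOrthogonalProjection] {κ : Type*} [Fintype κ] (c : κ → L) (i : ℕ) :
    (S.compress L).hellingerSupport ρ c i =
      {t | i ≤ (S.densityMatrix ρ (fun j => (c j : H)) t).rank} := by
  ext t
  have : (S.compress L).densityMatrix ρ c t = S.densityMatrix ρ (fun j => (c j : H)) t := by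
    ext j j'
    exact congr_fun (S.density_compress ρ L (c j) (c j')) t
  simp only [hellingerSupport, mem_ofPred_eq, multiplicity_eq_rank, this, Nat.cast_le]

theorem span_range_coe_orthonormalBasis {κ : Type*} [Fintype κ] {L : Submodule ℂ H}
    (c : OrthonormalBasis κ ℂ L) : Submodule.span ℂ (range fun j => (c j : H)) = L := by
  have h := c.toBasis.span_eq
  rw [OrthonormalBasis.coe_toBasis] at h
  have h2 := congr_arg (Submodule.map L.subtype) h
  rw [Submodule.map_span, ← range_comp, Submodule.map_subtype_top] at h2
  exact h2

theorem span_image_Iio (e : ℕ → H) (k : ℕ) :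
    Submodule.span ℂ (e '' Iio k) = Submodule.span ℂ (range fun i : Fin k => e i) := by
  congr 1
  ext x
  constructor
  · rintro ⟨i, hi, rfl⟩
    exact ⟨⟨i, hi⟩, rfl⟩
  · rintro ⟨i, rfl⟩
    exact ⟨i, i.2, rfl⟩

variable [SigmaFinite ρ]

theorem IsEquivalent.ae_rank_eq_of_span_eq (hS : S.IsEquivalent ρ) {κ κ' : Type*} [Fintype κ]
    [Fintype κ'] {v : κ → H} {f : κ' → H}
    (h : Submodule.span ℂ (range f) = Submodule.span ℂ (range v)) :
    ∀ᵐ t ∂ρ, (S.densityMatrix ρ f t).rank = (S.densityMatrix ρ v t).rank := by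
  filter_upwards [hS.ae_rank_le v f fun i => h ▸ Submodule.subset_span ⟨i, rfl⟩,
    hS.ae_rank_le f v fun i => h ▸ Submodule.subset_span ⟨i, rfl⟩] with t h1 h2
  exact le_antisymm h1 h2

/-- The rank on `H_k` never exceeds the multiplicity a.e.; conversely, on `Γ_i` with `i ≤ k` it is
at least `i`, because `det Ψ_i ≠ 0` there and the first `i` vectors lie in `H_k`. -/
theorem IsEquivalent.isHellingerChain_of_det (hS : S.IsEquivalent ρ)
    (hb : Dense (Submodule.span ℂ (range b) : Set H)) {e : ℕ → H}
    (he : ∀ k : ℕ, 1 ≤ k → (k : ℕ∞) ≤ S.totalMultiplicity ρ b →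
      S.hellingerSupport ρ b k =ᵐ[ρ]
        {t | (S.densityMatrix ρ (fun i : Fin k => e i) t).det ≠ 0}) :
    S.IsHellingerChain ρ b fun k => Submodule.span ℂ (e '' Iio k) := by
  refine ⟨fun k hk hm => ?_, fun k _ _ =>
    Submodule.span_mono (image_mono (Iio_subset_Iio (by omega)))⟩
  have hL := span_image_Iio e k
  have hfin : FiniteDimensional ℂ (Submodule.span ℂ (e '' Iio k)) :=
    FiniteDimensional.span_of_finite ℂ ((finite_Iio k).image e)
  refine ⟨hfin, ?_, fun c i hi hik => ?_⟩
  · refine le_antisymm ?_ ?_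
    · change Module.finrank ℂ (Submodule.span ℂ (e '' Iio k)) ≤ k
      rw [hL]
      exact (finrank_range_le_card _).trans_eq (Fintype.card_fin k)
    · change k ≤ Module.finrank ℂ (Submodule.span ℂ (e '' Iio k))
      by_contra! hlt
      refine not_ae_notMem_hellingerSupport hk hm ?_
      let c := stdOrthonormalBasis ℂ (Submodule.span ℂ (e '' Iio k))
      filter_upwards [(he k hk hm).mem_iff, hS.ae_rank_eq_of_span_eq
        (hL.symm.trans (span_range_coe_orthonormalBasis c).symm)] with t h1 h2 h3
      have h4 := (Matrix.rank_eq_card_iff_det_ne_zero _).2 (h1.1 h3)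
      have h5 := (S.densityMatrix ρ (fun j => (c j : H)) t).rank_le_card_width
      rw [Fintype.card_fin] at h4 h5
      omega
  · rw [hellingerSupport_compress]
    have him : (i : ℕ∞) ≤ S.totalMultiplicity ρ b := (Nat.cast_le.2 hik).trans hm
    refine eventuallyEq_set.2 ?_
    filter_upwards [(he i hi him).mem_iff,
      hS.ae_rank_le_multiplicity hb fun j => (c j : H),
      hS.ae_rank_le (fun j => (c j : H)) (fun j : Fin i => e j) fun j => by
        rw [span_range_coe_orthonormalBasis c]
        exact Submodule.subset_span ⟨j, j.2.trans_le hik, rfl⟩] with t h1 h2 h3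
    refine ⟨fun h => (Nat.cast_le.2 h).trans h2, fun h => ?_⟩
    have h4 := (Matrix.rank_eq_card_iff_det_ne_zero _).2 (h1.1 h)
    rw [Fintype.card_fin] at h4
    exact h4 ▸ h3

/-- Only the top support of each `H_k` matters: a `k × k` matrix has rank at least `k` exactly when
its determinant is nonzero. -/
theorem IsEquivalent.hellingerSupport_ae_eq_of_isHellingerChain (hS : S.IsEquivalent ρ) {e : ℕ → H}
    (he : S.IsHellingerChain ρ b fun k => Submodule.span ℂ (e '' Iio k)) {k : ℕ} (hk : 1 ≤ k)
    (hm : (k : ℕ∞) ≤ S.totalMultiplicity ρ b) :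
    S.hellingerSupport ρ b k =ᵐ[ρ]
      {t | (S.densityMatrix ρ (fun i : Fin k => e i) t).det ≠ 0} := by
  obtain ⟨hfin, hrank, h⟩ := he.1 k hk hm
  let c := (stdOrthonormalBasis ℂ (Submodule.span ℂ (e '' Iio k))).reindex (finCongr hrank)
  have h1 := h c k hk le_rfl
  rw [hellingerSupport_compress] at h1
  refine eventuallyEq_set.2 ?_
  filter_upwards [h1.mem_iff, hS.ae_rank_eq_of_span_eq
    ((span_image_Iio e k).symm.trans (span_range_coe_orthonormalBasis c).symm)] with t h1 h2
  have h3 := (S.densityMatrix ρ (fun i : Fin k => e i) t).rank_le_card_width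
  rw [← h1, ← Matrix.rank_eq_card_iff_det_ne_zero, ← h2]
  rw [Fintype.card_fin] at h3 ⊢
  omega

/-- Countability of `ι` leaves countably many finite index sets, so the greedy property holds for
all of them off one null set. -/
theorem IsEquivalent.hellingerSupport_ae_eq (hS : S.IsEquivalent ρ) [Countable ι]
    (hb : Dense (Submodule.span ℂ (range b) : Set H)) {e : ℕ → H}
    (he : ∀ (k : ℕ) (y : H), ∀ᵐ t ∂ρ,
      (S.densityMatrix ρ (Fin.snoc (fun i : Fin k => e i) y : Fin (k + 1) → H) t).det ≠ 0 →
      (S.densityMatrix ρ (fun i : Fin (k + 1) => e i) t).det ≠ 0) (k : ℕ) :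
    S.hellingerSupport ρ b k =ᵐ[ρ]
      {t | (S.densityMatrix ρ (fun i : Fin k => e i) t).det ≠ 0} := by
  refine eventuallyEq_set.2 ?_
  filter_upwards [hS.ae_le_multiplicity_of_det_ne_zero hb fun i : Fin k => e i,
    ae_all_iff.2 fun s : Finset ι => hS.ae_det_ne_zero_of_le_rank he (fun i : s => b i) k]
    with t h1 h2
  refine ⟨fun h => ?_, h1⟩
  obtain ⟨s, hs⟩ := (S.le_multiplicity_iff ρ b t k).1 h
  exact h2 s hs

end

end OperatorMeasure

open OperatorMeasure in
theorem theorem4 {H : Type u} [NormedAddCommGroup H] [InnerProductSpace ℂ H] [CompleteSpace H]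
    [TopologicalSpace.SeparableSpace H] (S : OperatorMeasure H) :
    (∀ h ∈ S.maximalVectors, ∃ K : ℕ → Submodule ℂ H,
      K 1 = Submodule.span ℂ {h} ∧
      ∀ (ρ : Measure ℝ) [SigmaFinite ρ], S.IsEquivalent ρ →
        ∀ (ι : Type v) (b : HilbertBasis ι ℂ H), S.IsHellingerChain ρ b K) ∧
    (∀ (ρ : Measure ℝ) [SigmaFinite ρ], S.IsEquivalent ρ →
      ∀ (ι : Type v) (b : HilbertBasis ι ℂ H) (e : ℕ → H),
        LinearIndependent ℂ (fun i : {i : ℕ // (i : ℕ∞) < S.totalMultiplicity ρ b} => e i) →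
        (S.IsHellingerChain ρ b (fun k => Submodule.span ℂ (e '' Iio k)) ↔
          ∀ k : ℕ, 1 ≤ k → (k : ℕ∞) ≤ S.totalMultiplicity ρ b →
            S.hellingerSupport ρ b k =ᵐ[ρ]
              {t | (S.densityMatrix ρ (fun i : Fin k => e i) t).det ≠ 0})) := by
  have hdense : ∀ (ι : Type v) (b : HilbertBasis ι ℂ H),
      Dense (Submodule.span ℂ (range b) : Set H) := fun ι b =>
    Submodule.dense_iff_topologicalClosure_eq_top.2 b.dense_span
  refine ⟨fun h hh => ?_, fun ρ _ hS ι b e _ => ⟨fun he k hk hm =>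
    hS.hellingerSupport_ae_eq_of_isHellingerChain he hk hm,
    fun he => hS.isHellingerChain_of_det (hdense ι b) he⟩⟩
  obtain ⟨e, he0, he⟩ := S.exists_seq_det_ne_zero hh
  refine ⟨fun k => Submodule.span ℂ (e '' Iio k), ?_, fun ρ _ hS ι b => ?_⟩
  · have : Iio 1 = ({0} : Set ℕ) := by ext; simp
    simp only [this, image_singleton, he0]
  · have := b.orthonormal.countable
    exact hS.isHellingerChain_of_det (hdense ι b) fun k _ _ =>
      hS.hellingerSupport_ae_eq (hdense ι b) (he ρ hS) k
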